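/- Let $(X,\Sigma,\mu)$ be a semi-finite measure space, i.e. every $S\in\Sigma$ with $\mu(S)=\infty$ contains some $T\in\Sigma$ with $0<\mu(T)<\infty$. Let $\mathrm{L}^0(X,\Sigma,\mu)$ be the vector lattice of measurable functions $X\to\mathbb{R}$, with identification of functions that are $\mu$-almost everywhere equal, and let $E$ be the ideal in $\mathrm{L}^0(X,\Sigma,\mu)$ consisting of the (equivalence classes of) functions whose support $\{x : f(x)\neq 0\}$ is contained in a countable union of measurable sets of finite measure. Let $E$ carry the topology of local convergence in measure, in which a net $(f_\alpha)$ converges to $f$ if and only if \[ \lim_\alpha \mu\big(\{t\in F: |f_\alpha(t)-f(t)|\geq \varepsilon\}\big)=0 \] for every $\varepsilon>0$ and every measurable $F\subseteq X$ with $\mu(F)<\infty$. Let $A$ be a subset of $E$. Then $A$ is a closed subset of $E$ in this topology if and only if $A$ contains the almost everywhere limits of sequences in $A$: whenever $(f_n)_{n\ge 1}$ is a sequence in $A$, $f\in \mathrm{L}^0(X,\Sigma,\mu)$, and $f_n\to f$ almost everywhere, then $f\in A$. -/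

import Mathlib

open MeasureTheory Filter Topology
open scoped ENNReal

/-- A measure is semi-finite when every measurable set of infinite measure contains a measurable
subset of finite, strictly positive measure. -/
def IsSemiFinite {X : Type*} [MeasurableSpace X] (μ : Measure X) : Prop :=
  ∀ S : Set X, MeasurableSet S → μ S = ∞ →
    ∃ T : Set X, T ⊆ S ∧ MeasurableSet T ∧ 0 < μ T ∧ μ T < ∞

/-- The elements of `L⁰(X, Σ, μ)` with `σ`-finite support: up to a null set (the support of an
equivalence class is only defined up to null sets), the support is contained in a countable union
of measurable sets of finite measure. -/
def sigmaFiniteSupp {X : Type*} [MeasurableSpace X] (μ : Measure X) :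
    Submodule ℝ (X →ₘ[μ] ℝ) where
  carrier := {f | ∃ s : ℕ → Set X, (∀ n, MeasurableSet (s n) ∧ μ (s n) < ∞) ∧
    ∀ᵐ x ∂μ, f x ≠ 0 → x ∈ ⋃ n, s n}
  zero_mem' := by
    refine ⟨fun _ => ∅, by simp, ?_⟩
    filter_upwards [AEEqFun.coeFn_zero (α := X) (μ := μ) (β := ℝ)] with x hx h
    exact absurd hx h
  add_mem' := by
    rintro f g ⟨s, hs, hfs⟩ ⟨t, ht, hgt⟩
    refine ⟨fun n => s n ∪ t n, fun n => ⟨(hs n).1.union (ht n).1,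
      measure_union_lt_top (hs n).2 (ht n).2⟩, ?_⟩
    filter_upwards [AEEqFun.coeFn_add f g, hfs, hgt] with x hx h1 h2 h
    rw [Set.iUnion_union_distrib]
    by_cases hf : f x = 0
    · exact Or.inr (h2 fun hg => h (by simp [hx, hf, hg]))
    · exact Or.inl (h1 hf)
  smul_mem' := by
    rintro c f ⟨s, hs, hfs⟩
    refine ⟨s, hs, ?_⟩
    filter_upwards [AEEqFun.coeFn_smul c f, hfs] with x hx h1 h
    exact h1 fun hf => h (by simp [hx, hf])

theorem mem_sigmaFiniteSupp_iff {X : Type*} [MeasurableSpace X] {μ : Measure X}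
    {f : X →ₘ[μ] ℝ} :
    f ∈ sigmaFiniteSupp μ ↔ ∃ s : ℕ → Set X, (∀ n, MeasurableSet (s n) ∧ μ (s n) < ∞) ∧
      Function.support (f : X → ℝ) ⊆ ⋃ n, s n := by
  constructor
  · rintro ⟨s, hs, h⟩
    set N : Set X := toMeasurable μ {x | ¬ (f x ≠ 0 → x ∈ ⋃ n, s n)} with hN
    have hN0 : μ N = 0 := by rw [hN, measure_toMeasurable]; exact h
    refine ⟨fun n => s n ∪ N, fun n => ⟨(hs n).1.union (measurableSet_toMeasurable _ _),
      measure_union_lt_top (hs n).2 (by simp [hN0])⟩, fun x hx => ?_⟩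
    by_cases hxs : x ∈ ⋃ n, s n
    · obtain ⟨n, hn⟩ := Set.mem_iUnion.1 hxs
      exact Set.mem_iUnion.2 ⟨n, Or.inl hn⟩
    · exact Set.mem_iUnion.2 ⟨0, Or.inr (subset_toMeasurable _ _ fun h' => hxs (h' hx))⟩
  · rintro ⟨s, hs, h⟩
    exact ⟨s, hs, Eventually.of_forall fun x hx => h hx⟩

/-- `sigmaFiniteSupp μ` is an order ideal of the vector lattice `L⁰(X, Σ, μ)`. -/
theorem sigmaFiniteSupp_solid {X : Type*} [MeasurableSpace X] {μ : Measure X}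
    {f g : X →ₘ[μ] ℝ} (hfg : |f| ≤ |g|) (hg : g ∈ sigmaFiniteSupp μ) :
    f ∈ sigmaFiniteSupp μ := by
  obtain ⟨s, hs, h⟩ := hg
  refine ⟨s, hs, ?_⟩
  filter_upwards [AEEqFun.coeFn_le.2 hfg, AEEqFun.coeFn_abs f, AEEqFun.coeFn_abs g, h]
    with x h1 h2 h3 h4 hf
  refine h4 fun hg0 => hf ?_
  rw [h2, h3, hg0, abs_zero] at h1
  exact abs_nonpos_iff.1 h1

/-- The basic neighbourhood of `f` for local convergence in measure given by a set `F` (which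
will be of finite measure) and `ε > 0`. -/
def localMeasureNhd {X : Type*} [MeasurableSpace X] (μ : Measure X) (F : Set X) (ε : ℝ)
    (f : X →ₘ[μ] ℝ) : Set (X →ₘ[μ] ℝ) :=
  {g | μ {x ∈ F | ε ≤ |g x - f x|} < ENNReal.ofReal ε}

theorem localMeasureNhd_mono {X : Type*} [MeasurableSpace X] {μ : Measure X} {F G : Set X}
    {ε δ : ℝ} (hFG : F ⊆ G) (hδ : δ ≤ ε) (f : X →ₘ[μ] ℝ) :
    localMeasureNhd μ G δ f ⊆ localMeasureNhd μ F ε f := by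
  intro g hg
  have hle : μ {x ∈ F | ε ≤ |g x - f x|} ≤ μ {x ∈ G | δ ≤ |g x - f x|} :=
    measure_mono fun _ hx => ⟨hFG hx.1, hδ.trans hx.2⟩
  exact hle.trans_lt (lt_of_lt_of_le hg (ENNReal.ofReal_le_ofReal hδ))

/-- The topology of local convergence in measure on `L⁰(X, Σ, μ)`. -/
@[reducible] def localMeasureTopology {X : Type*} [MeasurableSpace X] (μ : Measure X) :
    TopologicalSpace (X →ₘ[μ] ℝ) where
  IsOpen U := ∀ f ∈ U, ∃ F : Set X, MeasurableSet F ∧ μ F < ∞ ∧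
    ∃ ε : ℝ, 0 < ε ∧ localMeasureNhd μ F ε f ⊆ U
  isOpen_univ := fun _ _ => ⟨∅, by simp, by simp, 1, by simp, Set.subset_univ _⟩
  isOpen_inter := by
    rintro U V hU hV f ⟨hfU, hfV⟩
    obtain ⟨F, hF, hF', ε, hε, h1⟩ := hU f hfU
    obtain ⟨G, hG, hG', δ, hδ, h2⟩ := hV f hfV
    exact ⟨F ∪ G, hF.union hG, measure_union_lt_top hF' hG', min ε δ, lt_min hε hδ,
      Set.subset_inter
        ((localMeasureNhd_mono Set.subset_union_left (min_le_left _ _) f).trans h1)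
        ((localMeasureNhd_mono Set.subset_union_right (min_le_right _ _) f).trans h2)⟩
  isOpen_sUnion := by
    rintro S hS f ⟨U, hU, hfU⟩
    obtain ⟨F, hF, hF', ε, hε, h⟩ := hS U hU f hfU
    exact ⟨F, hF, hF', ε, hε, h.trans (Set.subset_sUnion_of_mem hU)⟩

theorem localMeasureNhd_mem_nhds {X : Type*} [MeasurableSpace X] {μ : Measure X} {F : Set X}
    (hF : MeasurableSet F) (hF' : μ F < ∞) {ε : ℝ} (hε : 0 < ε) (f : X →ₘ[μ] ℝ) :
    localMeasureNhd μ F ε f ∈ @nhds _ (localMeasureTopology μ) f := by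
  let _ := localMeasureTopology μ
  -- the interior of the basic neighbourhood, described explicitly
  refine mem_nhds_iff.2 ⟨{g | ∃ G : Set X, MeasurableSet G ∧ μ G < ∞ ∧ ∃ δ : ℝ, 0 < δ ∧
    localMeasureNhd μ G δ g ⊆ localMeasureNhd μ F ε f}, ?_, ?_, ⟨F, hF, hF', ε, hε, subset_rfl⟩⟩
  · rintro g ⟨G, -, -, δ, hδ, h⟩
    exact h (by simp [localMeasureNhd, hδ, not_le.2 hδ])
  · rintro g ⟨G, hG, hG', δ, hδ, h⟩
    refine ⟨G, hG, hG', δ / 2, by positivity, fun k hk => ⟨G, hG, hG', δ / 2, by positivity,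
      fun l hl => h ?_⟩⟩
    have hsub : {x ∈ G | δ ≤ |l x - g x|} ⊆
        {x ∈ G | δ / 2 ≤ |l x - k x|} ∪ {x ∈ G | δ / 2 ≤ |k x - g x|} := by
      rintro x ⟨hx, hx'⟩
      by_contra hcon
      simp only [Set.mem_union, Set.mem_ofPred_eq, hx, true_and, not_or, not_le] at hcon
      have := abs_sub_le (l x) (k x) (g x)
      linarith [hcon.1, hcon.2]
    calc μ {x ∈ G | δ ≤ |l x - g x|} ≤ _ := measure_mono hsub
      _ ≤ _ := measure_union_le _ _
      _ < ENNReal.ofReal (δ / 2) + ENNReal.ofReal (δ / 2) := ENNReal.add_lt_add hl hk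
      _ = ENNReal.ofReal δ := by
        rw [← ENNReal.ofReal_add (by positivity) (by positivity), add_halves]

/-- Convergence in `localMeasureTopology μ` is local convergence in measure. -/
theorem tendsto_localMeasureTopology_iff {X : Type*} [MeasurableSpace X] {μ : Measure X}
    {ι : Type*} {l : Filter ι} {u : ι → X →ₘ[μ] ℝ} {f : X →ₘ[μ] ℝ} :
    Tendsto u l (@nhds _ (localMeasureTopology μ) f) ↔
      ∀ ε : ℝ, 0 < ε → ∀ F : Set X, MeasurableSet F → μ F < ∞ →
        Tendsto (fun i => μ {x ∈ F | ε ≤ |u i x - f x|}) l (𝓝 0) := by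
  let _ := localMeasureTopology μ
  constructor
  · intro h ε hε F hF hF'
    refine ENNReal.tendsto_nhds_zero.2 fun δ hδ => ?_
    obtain ⟨r, hr, hr'⟩ : ∃ r : ℝ, 0 < r ∧ ENNReal.ofReal r ≤ δ := by
      rcases eq_or_ne δ ∞ with rfl | hδ'
      · exact ⟨1, one_pos, le_top⟩
      · exact ⟨δ.toReal, ENNReal.toReal_pos hδ.ne' hδ', ENNReal.ofReal_toReal_le⟩
    filter_upwards [h (localMeasureNhd_mem_nhds hF hF' (lt_min hε hr) f)] with i hi
    have hle : μ {x ∈ F | ε ≤ |u i x - f x|} ≤ μ {x ∈ F | min ε r ≤ |u i x - f x|} :=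
      measure_mono fun x hx => ⟨hx.1, (min_le_left _ _).trans hx.2⟩
    exact (hle.trans (le_of_lt hi)).trans
      ((ENNReal.ofReal_le_ofReal (min_le_right _ _)).trans hr')
  · intro h
    refine tendsto_nhds.2 fun U hU hfU => ?_
    obtain ⟨F, hF, hF', ε, hε, hsub⟩ := hU f hfU
    filter_upwards [(h ε hε F hF hF').eventually_lt_const (ENNReal.ofReal_pos.2 hε)] with i hi
    exact hsub hi

/-! Almost everywhere limits of sequences in `E` stay in `E` and, on sets of finite measure, are
limits in measure, so closed sets contain them. Conversely, let `f` in `E` be in the closure of `A`.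
Choose `u n` in `A` within `2⁻ⁿ` of `f` on `F n`, off a set of measure below `2⁻ⁿ`, where the
finite-measure sets `F n` increase to cover the supports of `f` and of every `u j`. By
Borel-Cantelli `u n → f` almost everywhere on the union of the `F n`; almost everywhere outside it,
all the functions vanish. -/

/-- An almost everywhere limit of a sequence of functions with `σ`-finite supports has
`σ`-finite support. -/
theorem mem_sigmaFiniteSupp_of_tendsto_ae {X : Type*} [MeasurableSpace X] {μ : Measure X}
    {u : ℕ → X →ₘ[μ] ℝ} {f : X →ₘ[μ] ℝ} (hu : ∀ n, u n ∈ sigmaFiniteSupp μ)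
    (h : ∀ᵐ x ∂μ, Tendsto (fun n => u n x) atTop (𝓝 (f x))) : f ∈ sigmaFiniteSupp μ := by
  choose s hs hsupp using hu
  refine ⟨fun m => s m.unpair.1 m.unpair.2, fun m => hs _ _, ?_⟩
  filter_upwards [h, ae_all_iff.2 hsupp] with x hx hx' hfx
  obtain ⟨n, hn⟩ := (hx.eventually_ne hfx).exists
  obtain ⟨k, hk⟩ := Set.mem_iUnion.1 (hx' n hn)
  exact Set.mem_iUnion.2 ⟨Nat.pair n k, by simpa using hk⟩

/-- Almost everywhere convergence of a sequence implies local convergence in measure. -/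
theorem tendsto_localMeasureTopology_of_tendsto_ae {X : Type*} [MeasurableSpace X]
    {μ : Measure X} {u : ℕ → X →ₘ[μ] ℝ} {f : X →ₘ[μ] ℝ}
    (h : ∀ᵐ x ∂μ, Tendsto (fun n => u n x) atTop (𝓝 (f x))) :
    Tendsto u atTop (@nhds _ (localMeasureTopology μ) f) := by
  refine tendsto_localMeasureTopology_iff.2 fun ε hε F hF hF' => ?_
  -- Convergence almost everywhere gives convergence in measure only for finite measures, hence the
  -- restriction to `F`.
  have : IsFiniteMeasure (μ.restrict F) := ⟨by simpa using hF'⟩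
  have key := tendstoInMeasure_of_tendsto_ae (μ := μ.restrict F)
    (fun n => (u n).aestronglyMeasurable.restrict) (ae_restrict_of_ae h)
  refine (tendstoInMeasure_iff_dist.1 key ε hε).congr fun n => ?_
  rw [Measure.restrict_apply' hF, Set.inter_comm]
  rfl

/-- A point of `sigmaFiniteSupp μ` all of whose basic neighbourhoods meet a set `A` of functions
with `σ`-finite supports is the almost everywhere limit of a sequence in `A`. -/
theorem exists_seq_tendsto_ae_of_localMeasureNhd_inter_nonempty {X : Type*} [MeasurableSpace X]
    {μ : Measure X} {A : Set (X →ₘ[μ] ℝ)} (hA : A ⊆ (sigmaFiniteSupp μ : Set (X →ₘ[μ] ℝ)))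
    {f : X →ₘ[μ] ℝ} (hf : f ∈ sigmaFiniteSupp μ)
    (h : ∀ F, MeasurableSet F → μ F < ∞ → ∀ ε : ℝ, 0 < ε → (localMeasureNhd μ F ε f ∩ A).Nonempty) :
    ∃ u : ℕ → X →ₘ[μ] ℝ, (∀ n, u n ∈ A) ∧
      ∀ᵐ x ∂μ, Tendsto (fun n => u n x) atTop (𝓝 (f x)) := by
  have hpos : ∀ n : ℕ, (0 : ℝ) < (1 / 2) ^ n := fun n => by positivity
  -- Total in `F`, with an arbitrary element of `A` as default: the recursion for `c` uses `G`
  -- before its sets are known to be measurable of finite measure.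
  have happrox : ∀ (F : Set X) (n : ℕ), ∃ g ∈ A, MeasurableSet F → μ F < ∞ →
      g ∈ localMeasureNhd μ F ((1 / 2) ^ n) f := fun F n => by
    by_cases hF : MeasurableSet F ∧ μ F < ∞
    · obtain ⟨g, hg, hgA⟩ := h F hF.1 hF.2 _ (hpos n)
      exact ⟨g, hgA, fun _ _ => hg⟩
    · obtain ⟨g, -, hgA⟩ := h ∅ .empty (by simp) 1 one_pos
      exact ⟨g, hgA, fun h1 h2 => absurd ⟨h1, h2⟩ hF⟩
  choose G hGA hG using happrox
  have hcover : ∀ g : X →ₘ[μ] ℝ, ∃ s : ℕ → Set X, g ∈ sigmaFiniteSupp μ →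
      (∀ n, MeasurableSet (s n) ∧ μ (s n) < ∞) ∧ ∀ᵐ x ∂μ, g x ≠ 0 → x ∈ ⋃ n, s n := fun g => by
    by_cases hg : g ∈ sigmaFiniteSupp μ
    · obtain ⟨s, hs⟩ := hg
      exact ⟨s, fun _ => hs⟩
    · exact ⟨fun _ => ∅, fun h => absurd h hg⟩
  choose s hs using hcover
  -- `c n` covers the supports of `f` and of the first `n` terms of the sequence
  let c : ℕ → ℕ → Set X := fun n =>
    Nat.rec (motive := fun _ => ℕ → Set X) (s f) (fun n t k => t k ∪ s (G (⋃ j ∈ Finset.range (n + 1), t j) n) k) n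
  -- Cutting off at `j ≤ n` keeps the measure finite, yet every `c m k` lies in `F n` once `n ≥ max
  -- m k`.
  let F : ℕ → Set X := fun n => ⋃ j ∈ Finset.range (n + 1), c n j
  let u : ℕ → X →ₘ[μ] ℝ := fun n => G (F n) n
  have hc_succ : ∀ n k, c (n + 1) k = c n k ∪ s (u n) k := fun _ _ => rfl
  have huA : ∀ n, u n ∈ A := fun n => hGA _ _
  have hc : ∀ n k, MeasurableSet (c n k) ∧ μ (c n k) < ∞ := by
    intro n
    induction n with
    | zero => exact (hs f hf).1
    | succ n ih =>
      intro k
      have hk := (hs _ (hA (huA n))).1 k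
      rw [hc_succ]
      exact ⟨(ih k).1.union hk.1, measure_union_lt_top (ih k).2 hk.2⟩
  have hF : ∀ n, MeasurableSet (F n) := fun n =>
    Finset.measurableSet_biUnion _ fun k _ => (hc n k).1
  have hF' : ∀ n, μ (F n) < ∞ := fun n =>
    measure_biUnion_lt_top (Finset.finite_toSet _) fun k _ => (hc n k).2
  have hc_mono : ∀ k, Monotone fun n => c n k := fun k =>
    monotone_nat_of_le_succ fun n => by rw [hc_succ]; exact Set.subset_union_left
  have hF_mem : ∀ {m n k x}, x ∈ c m k → m ≤ n → k ≤ n → x ∈ F n := fun {m n k x} hx hm hk =>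
    Set.mem_biUnion (Finset.mem_coe.2 (Finset.mem_range.2 (Nat.lt_succ_of_le hk))) (hc_mono k hm hx)
  refine ⟨u, huA, ?_⟩
  have hsum : ∑' n, μ {x ∈ F n | (1 / 2 : ℝ) ^ n ≤ |u n x - f x|} ≠ ∞ := by
    refine ne_top_of_le_ne_top (summable_geometric_two.tsum_ofReal_ne_top)
      (ENNReal.tsum_le_tsum fun n => (hG (F n) n (hF n) (hF' n)).le)
  filter_upwards [ae_eventually_notMem hsum, (hs f hf).2,
    ae_all_iff.2 fun n => (hs _ (hA (huA n))).2] with x hx hfx hux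
  rcases em (∃ m k, x ∈ c m k) with hxF | hxF
  · obtain ⟨m, k, hmk⟩ := hxF
    refine tendsto_iff_dist_tendsto_zero.2 (squeeze_zero' (Eventually.of_forall fun _ => dist_nonneg)
      ?_ (tendsto_pow_atTop_nhds_zero_of_lt_one (r := (1 / 2 : ℝ)) (by norm_num) (by norm_num)))
    filter_upwards [hx, eventually_ge_atTop m, eventually_ge_atTop k] with n hn hm hk
    exact (not_le.1 fun hle => hn ⟨hF_mem hmk hm hk, hle⟩).le
  · push Not at hxF
    have hf0 : f x = 0 := by
      by_contra h0
      obtain ⟨k, hk⟩ := Set.mem_iUnion.1 (hfx h0)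
      exact hxF 0 k hk
    have hu0 : ∀ n, u n x = 0 := fun n => by
      by_contra h0
      obtain ⟨k, hk⟩ := Set.mem_iUnion.1 (hux n h0)
      -- The cover of `u n` enters at stage `n + 1`, since `u n` is chosen using `c n`.
      exact hxF (n + 1) k (by rw [hc_succ]; exact Or.inr hk)
    simp [hf0, hu0]

/-- For a semi-finite measure, a set `A` of elements of `L⁰` with `σ`-finite supports is closed in
`E = sigmaFiniteSupp μ` for local convergence in measure iff it contains all almost everywhere
limits of sequences in `A`. -/
theorem mainTheorem9 {X : Type*} [MeasurableSpace X] (μ : Measure X) (hμ : IsSemiFinite μ)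
    (A : Set (X →ₘ[μ] ℝ)) (hA : A ⊆ (sigmaFiniteSupp μ : Set (X →ₘ[μ] ℝ))) :
    IsClosed[(localMeasureTopology μ).induced
        (Subtype.val : sigmaFiniteSupp μ → (X →ₘ[μ] ℝ))]
        {f : sigmaFiniteSupp μ | (f : X →ₘ[μ] ℝ) ∈ A} ↔
      ∀ (u : ℕ → (X →ₘ[μ] ℝ)) (f : X →ₘ[μ] ℝ), (∀ n, u n ∈ A) →
        (∀ᵐ x ∂μ, Tendsto (fun n => u n x) atTop (𝓝 (f x))) → f ∈ A := by
  let _ := localMeasureTopology μ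
  constructor
  · intro hclosed u f hu h
    obtain ⟨C, hC, hCA⟩ := isClosed_induced_iff.1 hclosed
    have hiff : ∀ g : sigmaFiniteSupp μ, (g : X →ₘ[μ] ℝ) ∈ C ↔ (g : X →ₘ[μ] ℝ) ∈ A :=
      fun g => Set.ext_iff.1 hCA g
    have hf : f ∈ sigmaFiniteSupp μ := mem_sigmaFiniteSupp_of_tendsto_ae (fun n => hA (hu n)) h
    exact (hiff ⟨f, hf⟩).1 (hC.mem_of_tendsto (tendsto_localMeasureTopology_of_tendsto_ae h)
      (Eventually.of_forall fun n => (hiff ⟨u n, hA (hu n)⟩).2 (hu n)))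
  · intro hseq
    -- The closure is taken in all of `L⁰`; it remains to see that its trace on `E` is `A`.
    refine isClosed_induced_iff.2 ⟨closure A, isClosed_closure, ?_⟩
    ext ⟨f, hf⟩
    refine ⟨fun hfA => ?_, fun hfA => subset_closure hfA⟩
    obtain ⟨u, hu, h⟩ := exists_seq_tendsto_ae_of_localMeasureNhd_inter_nonempty hA hf
      fun F hF hF' ε hε => mem_closure_iff_nhds.1 hfA _ (localMeasureNhd_mem_nhds hF hF' hε f)
    exact hseq u f hu h
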